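/- Let $d\in\{2,3\}$, let $\mathbb T^d=(\mathbb R/\mathbb Z)^d$, and let $\mathcal V$ be the space of $C^\infty$ vector fields $\varphi:\mathbb T^d\to\mathbb R^d$ with $\nabla\cdot\varphi=0$. Let $\mathbb V$ be the closure of $\mathcal V$ in $H^1(\mathbb T^d;\mathbb R^d)$, normed by $\|y\|_{\mathbb V}^2=\int_{\mathbb T^d}(|y|^2+|\nabla y|^2)\,dx$, and let $\mathbb V'$ be its dual, with duality pairing $\langle\cdot,\cdot\rangle$. Write $\|\cdot\|_{\mathbb H}$ for the $L^2(\mathbb T^d)$ norm (of vector fields and, with the Frobenius norm $|\cdot|$, of gradients) and $\|y\|_{\widetilde{\mathbb L}^4}=\big(\int_{\mathbb T^d}|y|^4\,dx\big)^{1/4}$. For $y,z,w\in\mathbb V$ put $$b(y,z,w)=\sum_{i,j=1}^d\int_{\mathbb T^d}y_i\,\frac{\partial z_j}{\partial x_i}\,w_j\,dx .$$ Then $\mathbb V\subset L^4(\mathbb T^d;\mathbb R^d)$, the integrals defining $b$ converge absolutely, and for all $y,z\in\mathbb V$ the form $b(y,z,\cdot)$ is an element of $\mathbb V'$, denoted $\mathcal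 B(y,z)$. Put $\mathcal B(y)=\mathcal B(y,y)$, and for an integer $N\ge 0$ define $\mathcal B_N:\mathbb V\to\mathbb V'$ by $$\mathcal B_N(y)=\begin{cases}\mathcal B(y), & \|y\|_{\widetilde{\mathbb L}^4}\le N,\\[2pt] \Big(\dfrac{N}{\|y\|_{\widetilde{\mathbb L}^4}}\Big)^{4}\mathcal B(y), & \|y\|_{\widetilde{\mathbb L}^4}>N.\end{cases}$$ For every $\mu>0$ and every integer $N\ge 0$ there is a constant $C_N\ge 0$, depending only on $N$, $\mu$ and $d$, such that $$|\langle \mathcal B_N(y)-\mathcal B_N(z),\,y-z\rangle|\le\frac{\mu}{2}\,\|\nabla(y-z)\|_{\mathbb H}^2+C_N\,\|y-z\|_{\mathbb H}^2\qquad\text{for all }y,z\in\mathbb V .$$ -/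

import Mathlib

open MeasureTheory
open scoped ContDiff ENNReal

noncomputable section

namespace CBF

/-- Vector fields on the torus `(ℝ/ℤ)^d` with values in Euclidean `ℝ^d`. -/
abbrev Field (d : ℕ) := UnitAddTorus (Fin d) → EuclideanSpace ℝ (Fin d)

/-- The quotient map `ℝ^d → (ℝ/ℤ)^d`. -/
def proj (d : ℕ) (x : Fin d → ℝ) : UnitAddTorus (Fin d) := fun i => (x i : UnitAddCircle)

/-- `u` is infinitely differentiable on the torus: its `ℤ^d`-periodic lift to `ℝ^d` is. -/
def IsSmooth {d : ℕ} (u : Field d) : Prop :=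
  ContDiff ℝ ∞ (fun x : Fin d → ℝ => u (proj d x))

/-- The classical partial derivative `∂u_j/∂x_i` at the point `p` of the torus. -/
def partialDeriv {d : ℕ} (u : Field d) (i j : Fin d) (p : UnitAddTorus (Fin d)) : ℝ :=
  deriv (fun t : ℝ => u (p + Pi.single i (t : UnitAddCircle)) j) 0

/-- The classical gradient, with entry `∂u_j/∂x_i` at the index `(i, j)`; the Euclidean norm on
the matrix entries is the Frobenius norm. -/
def classicalGrad {d : ℕ} (u : Field d) (p : UnitAddTorus (Fin d)) :
    EuclideanSpace ℝ (Fin d × Fin d) :=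
  WithLp.toLp 2 (fun ij => partialDeriv u ij.1 ij.2 p)

/-- The smooth divergence-free periodic vector fields. -/
def IsTestField {d : ℕ} (u : Field d) : Prop :=
  IsSmooth u ∧ ∀ p, ∑ i, partialDeriv u i i p = 0

/-- Along a coordinate line a smooth field is differentiable. -/
theorem IsSmooth.differentiableAt_line {d : ℕ} {u : Field d} (hu : IsSmooth u) (i j : Fin d)
    (p : UnitAddTorus (Fin d)) :
    DifferentiableAt ℝ (fun t : ℝ => u (p + Pi.single i (t : UnitAddCircle)) j) 0 := by
  have hs : ∃ x : Fin d → ℝ, proj d x = p := by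
    choose x hx using fun k => QuotientAddGroup.mk_surjective (p k)
    exact ⟨x, funext hx⟩
  obtain ⟨x, rfl⟩ := hs
  have h : (fun t : ℝ => u (proj d x + Pi.single i (t : UnitAddCircle)) j)
      = fun t : ℝ => u (proj d (x + Pi.single i t)) j := by
    funext t
    suffices hk : proj d x + Pi.single i (t : UnitAddCircle) = proj d (x + Pi.single i t) by
      rw [hk]
    funext k
    by_cases hk : k = i
    · subst hk
      simp [proj]
    · simp [proj, hk]
  rw [h]
  have hd : Differentiable ℝ (fun x : Fin d → ℝ => u (proj d x)) := hu.differentiable (by simp)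
  have hl : Differentiable ℝ (fun t : ℝ => x + (Pi.single i t : Fin d → ℝ)) := by
    refine differentiable_pi.2 fun k => ?_
    by_cases hk : k = i
    · subst hk
      simpa using differentiable_id.const_add (x k)
    · simp [hk]
  have hc : Differentiable ℝ (fun t : ℝ => u (proj d (x + Pi.single i t))) := hd.comp hl
  exact (differentiable_euclidean.1 hc j) 0

theorem partialDeriv_add {d : ℕ} {u v : Field d} (hu : IsSmooth u) (hv : IsSmooth v)
    (i j : Fin d) (p : UnitAddTorus (Fin d)) :
    partialDeriv (u + v) i j p = partialDeriv u i j p + partialDeriv v i j p := by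
  simpa [partialDeriv] using
    deriv_fun_add (hu.differentiableAt_line i j p) (hv.differentiableAt_line i j p)

theorem partialDeriv_smul {d : ℕ} (c : ℝ) (u : Field d)
    (i j : Fin d) (p : UnitAddTorus (Fin d)) :
    partialDeriv (c • u) i j p = c * partialDeriv u i j p := by
  simp [partialDeriv]

theorem IsTestField.add {d : ℕ} {u v : Field d} (hu : IsTestField u) (hv : IsTestField v) :
    IsTestField (u + v) := by
  refine ⟨ContDiff.add hu.1 hv.1, fun p => ?_⟩
  simp only [partialDeriv_add hu.1 hv.1, Finset.sum_add_distrib, hu.2, hv.2, add_zero]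

theorem IsTestField.smul {d : ℕ} (c : ℝ) {u : Field d} (hu : IsTestField u) :
    IsTestField (c • u) := by
  refine ⟨ContDiff.const_smul c hu.1, fun p => ?_⟩
  simp only [partialDeriv_smul, ← Finset.mul_sum, hu.2, mul_zero]

theorem IsTestField.zero {d : ℕ} : IsTestField (0 : Field d) :=
  ⟨contDiff_const, fun p => by simp [partialDeriv]⟩

/-- `L²(𝕋^d; ℝ^d)`, with norm `(∫ |u|²)^{1/2}`. -/
abbrev L2Field (d : ℕ) := Lp (EuclideanSpace ℝ (Fin d)) 2 (volume : Measure (UnitAddTorus (Fin d)))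

/-- `L²(𝕋^d; ℝ^{d×d})`, with norm `(∫ |G|²)^{1/2}` for the Frobenius norm `|G|`. -/
abbrev L2Mat (d : ℕ) :=
  Lp (EuclideanSpace ℝ (Fin d × Fin d)) 2 (volume : Measure (UnitAddTorus (Fin d)))

/-- The Hilbert sum `L² × L²`, whose norm at `(u, ∇u)` is the `H¹` norm
`(∫ |u|² + |∇u|²)^{1/2}`. -/
abbrev L2Pair (d : ℕ) := WithLp 2 (L2Field d × L2Mat d)

/-- The smooth divergence-free fields with the `H¹` norm, as the space of pairs `(φ, ∇φ)`. -/
def testSpace (d : ℕ) : Submodule ℝ (L2Pair d) where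
  carrier := {p | ∃ φ : Field d, IsTestField φ ∧
    p.fst =ᵐ[volume] φ ∧ p.snd =ᵐ[volume] classicalGrad φ}
  zero_mem' := by
    refine ⟨0, IsTestField.zero, Lp.coeFn_zero _ _ _, ?_⟩
    filter_upwards [Lp.coeFn_zero (EuclideanSpace ℝ (Fin d × Fin d)) 2
      (volume : Measure (UnitAddTorus (Fin d)))] with x hx
    refine hx.trans ?_
    ext ij
    simp [classicalGrad, partialDeriv]
  add_mem' := by
    rintro p q ⟨φ, hφ, h1, h2⟩ ⟨ψ, hψ, k1, k2⟩
    refine ⟨φ + ψ, hφ.add hψ, ?_, ?_⟩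
    · filter_upwards [Lp.coeFn_add p.fst q.fst, h1, k1] with x hx a b
      refine hx.trans ?_
      simp [a, b]
    · filter_upwards [Lp.coeFn_add p.snd q.snd, h2, k2] with x hx a b
      refine hx.trans ?_
      ext ij
      simp [a, b, classicalGrad, partialDeriv_add hφ.1 hψ.1]
  smul_mem' := by
    rintro c p ⟨φ, hφ, h1, h2⟩
    refine ⟨c • φ, hφ.smul c, ?_, ?_⟩
    · filter_upwards [Lp.coeFn_smul c p.fst, h1] with x hx a
      refine hx.trans ?_
      simp [a]
    · filter_upwards [Lp.coeFn_smul c p.snd, h2] with x hx a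
      refine hx.trans ?_
      ext ij
      simp [a, classicalGrad, partialDeriv_smul]

/-- The space `V`: the closure of the smooth divergence-free fields in the `H¹` norm. An element
is a field together with its weak gradient. -/
abbrev V (d : ℕ) := (testSpace d).topologicalClosure

/-- The field `y ∈ L²` underlying an element of `V`. -/
def field {d : ℕ} (y : V d) : L2Field d := (y : L2Pair d).fst

/-- The (weak) gradient `∇y ∈ L²` of an element of `V`, with entries `∂y_j/∂x_i` at `(i, j)`. -/
def grad {d : ℕ} (y : V d) : L2Mat d := (y : L2Pair d).snd

/-- The norm of `L⁴(𝕋^d; ℝ^d)`, that is `(∫ |y|⁴)^{1/4}`. -/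
def normL4 {d : ℕ} (y : V d) : ℝ := (eLpNorm (field y) 4 volume).toReal

/-- The trilinear form `b(y, z, w) = ∑_{i,j} ∫ y_i (∂z_j/∂x_i) w_j`. -/
def b {d : ℕ} (y z w : V d) : ℝ :=
  ∑ i, ∑ j, ∫ x, field y x i * grad z x (i, j) * field w x j

open Classical in
/-- The element `B(y, z)` of the dual `V'` with `⟨B(y, z), w⟩ = b(y, z, w)`, when `b(y, z, ·)` is a
continuous linear form on `V` (and `0` otherwise). -/
def B₂ {d : ℕ} (y z : V d) : StrongDual ℝ (V d) :=
  if h : ∃ f : StrongDual ℝ (V d), ∀ w, f w = b y z w then h.choose else 0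

/-- The convective term `B(y) = B(y, y)`. -/
def B {d : ℕ} (y : V d) : StrongDual ℝ (V d) := B₂ y y

open Classical in
/-- The `L⁴`-quantized convective term. -/
def BN {d : ℕ} (N : ℕ) (y : V d) : StrongDual ℝ (V d) :=
  if normL4 y ≤ N then B y else ((N : ℝ) / normL4 y) ^ 4 • B y

end CBF

end

/-!
The convective term is antisymmetric in its last two arguments, so `⟨B(y), w⟩ = -b(y, w, y)` and
`⟨B(z), w⟩ = -b(z, w, z)`. With `w = y - z`, and `z` the field of smaller `L⁴` norm, the pairing
`⟨B_N(y) - B_N(z), w⟩` becomes `-χ(y) b(w, w, z) + (χ(z) - χ(y)) b(z, w, z)`, where `χ` denotes the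
damping factor. By Hölder's inequality both terms are bounded by a multiple of
`N ‖w‖_{L⁴} ‖∇w‖_{L²}`: the first because `χ(y) ‖z‖_{L⁴} ≤ N` (`cutoff_mul_le`), the second because
`|χ(z) - χ(y)| ‖z‖²_{L⁴} ≤ 4 N ‖w‖_{L⁴}` (`abs_cutoff_sub_mul_sq_le`). It remains to interpolate
`‖w‖_{L⁴} ≤ ε ‖∇w‖_{L²} + K_ε ‖w‖_{L²}` and to absorb with Young's inequality.

The interpolation comes from the Ladyzhenskaya inequalities. On a closed coordinate line, the
fundamental theorem of calculus bounds a continuously differentiable function by the line integral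
of `|g| + |∂ᵢ g|`; Mathlib's grid-lines lemma for product measures turns these bounds into the
endpoint Gagliardo–Nirenberg–Sobolev inequality on the torus
(`lintegral_rpow_le_of_hasContPartial`). Applied to `|u|²` for `d = 2` and to `|u|⁴` for `d = 3`, it
gives `∫ |u|⁴ ≤ ‖u‖ (‖u‖ + 4 ‖∇u‖)³` for smooth `u`. Fatou's lemma extends the resulting linear
bound to `V`, which yields the embedding into `L⁴` and the continuity of `b`.

The identity `b(y, w, w) = 0`, equivalent to antisymmetry, holds for smooth divergence-free fields
because partial derivatives have mean zero, and passes to `V` by density and continuity.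
-/

namespace CBF

open Function Filter Topology
open scoped NNReal

/-! ### Calculus along the coordinate lines of the torus -/

/-- The continuous real function `g` on the torus is differentiable in the `i`-th coordinate
direction, with continuous partial derivative `g'`. Differentiability along a line is required at
`0` only, but for every base point. -/
structure HasContPartial {d : ℕ} (i : Fin d) (g g' : UnitAddTorus (Fin d) → ℝ) : Prop where
  cont : Continuous g
  cont' : Continuous g'
  hasDerivAt_zero : ∀ p, HasDerivAt (fun t : ℝ => g (p + Pi.single i (t : UnitAddCircle))) (g' p) 0

namespace HasContPartial

variable {d : ℕ} {i : Fin d} {g g' h h' : UnitAddTorus (Fin d) → ℝ}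

theorem hasDerivAt (hg : HasContPartial i g g') (p : UnitAddTorus (Fin d)) (t : ℝ) :
    HasDerivAt (fun t : ℝ => g (p + Pi.single i (t : UnitAddCircle)))
      (g' (p + Pi.single i (t : UnitAddCircle))) t := by
  have h0 := hg.hasDerivAt_zero (p + Pi.single i (t : UnitAddCircle))
  have h1 := HasDerivAt.comp_sub_const t t (by simpa using h0)
  refine h1.congr_of_eventuallyEq (Eventually.of_forall fun s => ?_)
  simp only [add_assoc, ← Pi.single_add, ← AddCircle.coe_add, add_sub_cancel]

theorem mul (hg : HasContPartial i g g') (hh : HasContPartial i h h') :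
    HasContPartial i (fun p => g p * h p) (fun p => g' p * h p + g p * h' p) where
  cont := hg.cont.mul hh.cont
  cont' := (hg.cont'.mul hh.cont).add (hg.cont.mul hh.cont')
  hasDerivAt_zero p := by
    simpa using (hg.hasDerivAt_zero p).fun_mul (hh.hasDerivAt_zero p)

theorem sum {ι : Type*} (s : Finset ι) {G G' : ι → UnitAddTorus (Fin d) → ℝ}
    (hG : ∀ j ∈ s, HasContPartial i (G j) (G' j)) :
    HasContPartial i (fun p => ∑ j ∈ s, G j p) (fun p => ∑ j ∈ s, G' j p) where
  cont := continuous_finsetSum s fun j hj => (hG j hj).cont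
  cont' := continuous_finsetSum s fun j hj => (hG j hj).cont'
  hasDerivAt_zero p := HasDerivAt.fun_sum fun j hj => (hG j hj).hasDerivAt_zero p

/-- A partial derivative has mean zero, because translations preserve the integral of `g`. -/
theorem integral_eq_zero (hg : HasContPartial i g g') : ∫ p, g' p = 0 := by
  obtain ⟨C, hC⟩ := isCompact_univ.exists_bound_of_continuousOn hg.cont'.continuousOn
  have hshift (t : ℝ) : Continuous fun p : UnitAddTorus (Fin d) =>
      p + Pi.single i (t : UnitAddCircle) := by fun_prop
  let F : ℝ → UnitAddTorus (Fin d) → ℝ := fun t p => g (p + Pi.single i (t : UnitAddCircle))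
  let F' : ℝ → UnitAddTorus (Fin d) → ℝ := fun t p => g' (p + Pi.single i (t : UnitAddCircle))
  have key := (hasDerivAt_integral_of_dominated_loc_of_deriv_le
    (μ := (volume : Measure (UnitAddTorus (Fin d))))
    (F := F) (F' := F')
    (x₀ := 0) (bound := fun _ => C) (s := Set.univ) univ_mem
    (Eventually.of_forall fun t => by exact (hg.cont.comp (hshift t)).aestronglyMeasurable)
    ((hg.cont.comp (hshift 0)).integrable_of_hasCompactSupport
      (HasCompactSupport.of_compactSpace _))
    (hg.cont'.comp (hshift 0)).aestronglyMeasurable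
    (Eventually.of_forall fun p t _ => hC _ trivial)
    (integrable_const C)
    (Eventually.of_forall fun p t _ => hg.hasDerivAt p t)).2
  simp only [F, F',
    integral_add_right_eq_self (μ := (volume : Measure (UnitAddTorus (Fin d))))] at key
  exact key.unique (hasDerivAt_const 0 _)

/-- The value of `g` at a point is controlled by the integral of `|g| + |∂ᵢg|` over the closed
coordinate line through that point. -/
theorem enorm_le_lintegral_line (hg : HasContPartial i g g') (p : UnitAddTorus (Fin d)) :
    ‖g p‖ₑ ≤ ∫⁻ s : UnitAddCircle, (‖g (update p i s)‖ₑ + ‖g' (update p i s)‖ₑ) := by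
  set G : ℝ → ℝ := fun t => g (p + Pi.single i (t : UnitAddCircle)) with hG
  set G' : ℝ → ℝ := fun t => g' (p + Pi.single i (t : UnitAddCircle)) with hG'
  have hline : Continuous fun t : ℝ => p + Pi.single i (t : UnitAddCircle) := by
    refine continuous_const.add ((continuous_single i).comp (AddCircle.continuous_mk' 1))
  have hGc : Continuous G := hg.cont.comp hline
  have hGc' : Continuous G' := hg.cont'.comp hline
  have hupd (s : UnitAddCircle) : update p i (p i + s) = p + Pi.single i s := by
    ext k
    by_cases hk : k = i
    · subst hk; simp
    · simp [hk]
  -- the integral over the line, in the real coordinate centred at `p`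
  have hrhs : ∫⁻ s : UnitAddCircle, (‖g (update p i s)‖ₑ + ‖g' (update p i s)‖ₑ)
      = ∫⁻ t in Set.Ioc (0 : ℝ) 1, (‖G t‖ₑ + ‖G' t‖ₑ) := by
    rw [← lintegral_add_left_eq_self _ (p i)]
    simp only [hupd]
    rw [← UnitAddCircle.lintegral_preimage 0]
    simp [hG, hG']
  have hstep : ∀ t ∈ Set.Ioc (0 : ℝ) 1, ‖g p‖ₑ ≤ ‖G t‖ₑ + ∫⁻ s in Set.Ioc (0 : ℝ) 1, ‖G' s‖ₑ := by
    intro t ht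
    have hftc : ∫ s in (0 : ℝ)..t, G' s = G t - g p := by
      rw [intervalIntegral.integral_eq_sub_of_hasDerivAt (fun s _ => hg.hasDerivAt p s)
        (hGc'.intervalIntegrable _ _)]
      simp [hG]
    have h1 : g p = G t - ∫ s in (0 : ℝ)..t, G' s := by rw [hftc]; ring
    rw [h1]
    refine (enorm_sub_le).trans (add_le_add le_rfl ?_)
    rw [intervalIntegral.integral_of_le ht.1.le]
    refine (enorm_integral_le_lintegral_enorm _).trans ?_
    exact lintegral_mono_set (Set.Ioc_subset_Ioc_right ht.2)
  rw [hrhs, lintegral_add_left hGc.enorm.measurable]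
  calc ‖g p‖ₑ = ∫⁻ _ in Set.Ioc (0 : ℝ) 1, ‖g p‖ₑ := by simp
    _ ≤ ∫⁻ t in Set.Ioc (0 : ℝ) 1, (‖G t‖ₑ + ∫⁻ s in Set.Ioc (0 : ℝ) 1, ‖G' s‖ₑ) :=
        setLIntegral_mono' measurableSet_Ioc hstep
    _ = _ := by
        rw [lintegral_add_left hGc.enorm.measurable]
        simp

end HasContPartial

/-! ### Sobolev inequality on the torus -/

/-- The Gagliardo–Nirenberg–Sobolev inequality for the exponent `1` on the torus. -/
theorem lintegral_rpow_le_of_hasContPartial {d : ℕ} {p : ℝ} (hp : Real.HolderConjugate d p)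
    {g : UnitAddTorus (Fin d) → ℝ} {g' : Fin d → UnitAddTorus (Fin d) → ℝ}
    (hg : ∀ i, HasContPartial i g (g' i)) {D : UnitAddTorus (Fin d) → ℝ≥0∞}
    (hD : Measurable D) (hD' : ∀ i x, ‖g' i x‖ₑ ≤ D x) :
    ∫⁻ x, ‖g x‖ₑ ^ p ≤ (∫⁻ x, (‖g x‖ₑ + D x)) ^ p := by
  have hd1 : (1 : ℝ) < d := hp.lt
  have hd0 : 0 < d := by
    rcases Nat.eq_zero_or_pos d with h | h
    · subst h; norm_num at hd1
    · exact h
  have hgc : Continuous g := (hg ⟨0, hd0⟩).cont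
  calc ∫⁻ x, ‖g x‖ₑ ^ p
      = ∫⁻ x, ∏ _i : Fin d, ‖g x‖ₑ ^ ((1 : ℝ) / (Fintype.card (Fin d) - 1 : ℝ)) := by
        congr! 2 with x
        rw [Finset.prod_const, ← ENNReal.rpow_natCast, ← ENNReal.rpow_mul]
        congr 1
        rw [hp.conjugate_eq]
        simp
        field_simp
    _ ≤ ∫⁻ x, ∏ i, (∫⁻ s, (fun x => ‖g x‖ₑ + D x) (update x i s))
          ^ ((1 : ℝ) / (Fintype.card (Fin d) - 1 : ℝ)) := by
        gcongr with x i
        · simp; linarith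
        · refine ((hg i).enorm_le_lintegral_line x).trans (lintegral_mono fun s => ?_)
          exact add_le_add le_rfl (hD' i _)
    _ ≤ (∫⁻ x, (‖g x‖ₑ + D x)) ^ p := by
        refine lintegral_prod_lintegral_pow_le (fun _ => volume) (by simpa using hp) ?_
        exact hgc.enorm.measurable.add hD

/-! ### Smooth fields and the Ladyzhenskaya inequalities -/

theorem isOpenQuotientMap_proj (d : ℕ) : IsOpenQuotientMap (proj d) :=
  IsOpenQuotientMap.piMap fun _ => QuotientAddGroup.isOpenQuotientMap_mk

theorem proj_add_single {d : ℕ} (x : Fin d → ℝ) (i : Fin d) (t : ℝ) :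
    proj d x + Pi.single i (t : UnitAddCircle) = proj d (x + Pi.single i t) := by
  funext k
  by_cases hk : k = i
  · subst hk
    simp [proj]
  · simp [proj, hk]

theorem IsSmooth.continuous {d : ℕ} {u : Field d} (hu : IsSmooth u) : Continuous u :=
  (isOpenQuotientMap_proj d).isQuotientMap.continuous_iff.2 (ContDiff.continuous hu)

theorem IsSmooth.continuous_partialDeriv {d : ℕ} {u : Field d} (hu : IsSmooth u) (i j : Fin d) :
    Continuous (partialDeriv u i j) := by
  refine (isOpenQuotientMap_proj d).isQuotientMap.continuous_iff.2 ?_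
  have hd : Differentiable ℝ (fun x : Fin d → ℝ => u (proj d x)) := hu.differentiable (by simp)
  have hfd : Continuous (fderiv ℝ (fun x : Fin d → ℝ => u (proj d x))) :=
    hu.continuous_fderiv (by simp)
  have heq : partialDeriv u i j ∘ proj d
      = fun x => fderiv ℝ (fun x : Fin d → ℝ => u (proj d x)) x (Pi.single i 1) j := by
    funext x
    have hl : HasDerivAt (fun t : ℝ => x + (Pi.single i t : Fin d → ℝ)) (Pi.single i 1) 0 := by
      refine hasDerivAt_pi.2 fun k => ?_
      by_cases hk : k = i
      · subst hk
        simpa using (hasDerivAt_id (0 : ℝ)).const_add (x k)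
      · simpa [hk] using hasDerivAt_const (0 : ℝ) (x k)
    have hc := (show HasFDerivAt (fun x : Fin d → ℝ => u (proj d x)) _ (x + Pi.single i 0) from
      (hd _).hasFDerivAt).comp_hasDerivAt (0 : ℝ) hl
    have hj := (EuclideanSpace.proj (𝕜 := ℝ) j).hasFDerivAt.comp_hasDerivAt (0 : ℝ) hc
    simp only [Pi.single_zero, add_zero] at hj
    simp only [comp_apply, partialDeriv, proj_add_single]
    exact hj.deriv
  rw [heq]
  exact (EuclideanSpace.proj (𝕜 := ℝ) j).continuous.comp (hfd.clm_apply continuous_const)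

theorem IsSmooth.continuous_classicalGrad {d : ℕ} {u : Field d} (hu : IsSmooth u) :
    Continuous (classicalGrad u) :=
  (PiLp.continuous_toLp 2 _).comp
    (continuous_pi fun ij : Fin d × Fin d => hu.continuous_partialDeriv ij.1 ij.2)

theorem IsSmooth.hasContPartial {d : ℕ} {u : Field d} (hu : IsSmooth u) (i j : Fin d) :
    HasContPartial i (fun p => u p j) (partialDeriv u i j) where
  cont := (EuclideanSpace.proj (𝕜 := ℝ) j).continuous.comp hu.continuous
  cont' := hu.continuous_partialDeriv i j
  hasDerivAt_zero p := (hu.differentiableAt_line i j p).hasDerivAt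

theorem IsSmooth.hasContPartial_norm_sq {d : ℕ} {u : Field d} (hu : IsSmooth u) (i : Fin d) :
    HasContPartial i (fun p => ‖u p‖ ^ 2) (fun p => 2 * ∑ j, u p j * partialDeriv u i j p) := by
  have h := HasContPartial.sum Finset.univ fun j _ =>
    (hu.hasContPartial i j).mul (hu.hasContPartial i j)
  convert h using 1
  · funext p
    rw [EuclideanSpace.real_norm_sq_eq]
    exact Finset.sum_congr rfl fun _ _ => pow_two _
  · funext p
    rw [Finset.mul_sum]
    exact Finset.sum_congr rfl fun j _ => by ring

theorem abs_sum_mul_partialDeriv_le {d : ℕ} (u : Field d) (i : Fin d) (p : UnitAddTorus (Fin d)) :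
    |∑ j, u p j * partialDeriv u i j p| ≤ ‖u p‖ * ‖classicalGrad u p‖ := by
  refine abs_le_of_sq_le_sq ?_ (by positivity)
  rw [mul_pow, EuclideanSpace.real_norm_sq_eq, EuclideanSpace.real_norm_sq_eq]
  refine (Finset.sum_mul_sq_le_sq_mul_sq _ _ _).trans ?_
  gcongr
  rw [Fintype.sum_prod_type]
  exact Finset.single_le_sum (f := fun i => ∑ j, classicalGrad u p (i, j) ^ 2)
    (fun _ _ => Finset.sum_nonneg fun _ _ => sq_nonneg _) (Finset.mem_univ i)

/-- Cauchy–Schwarz for lower Lebesgue integrals, in squared form. -/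
theorem sq_lintegral_mul_le {α : Type*} [MeasurableSpace α] {ν : Measure α} {f g : α → ℝ≥0∞}
    (hf : AEMeasurable f ν) (hg : AEMeasurable g ν) :
    (∫⁻ x, f x * g x ∂ν) ^ 2 ≤ (∫⁻ x, f x ^ 2 ∂ν) * ∫⁻ x, g x ^ 2 ∂ν := by
  have h := ENNReal.lintegral_mul_le_Lp_mul_Lq ν Real.HolderConjugate.two_two hf hg
  simp only [Pi.mul_apply, ENNReal.rpow_two] at h
  calc (∫⁻ x, f x * g x ∂ν) ^ 2
      ≤ ((∫⁻ x, f x ^ 2 ∂ν) ^ ((1 : ℝ) / 2) * (∫⁻ x, g x ^ 2 ∂ν) ^ ((1 : ℝ) / 2)) ^ 2 := by gcongr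
    _ = _ := by
      rw [mul_pow, ← ENNReal.rpow_natCast, ← ENNReal.rpow_natCast, ← ENNReal.rpow_mul,
        ← ENNReal.rpow_mul]
      norm_num

theorem eLpNorm_natCast_pow {α E : Type*} [MeasurableSpace α] [NormedAddCommGroup E]
    {ν : Measure α} (f : α → E) {n : ℕ} (hn : n ≠ 0) :
    eLpNorm f n ν ^ n = ∫⁻ x, ‖f x‖ₑ ^ n ∂ν := by
  have := eLpNorm_nnreal_pow_eq_lintegral (μ := ν) (f := f) (p := (n : ℝ≥0)) (by exact_mod_cast hn)
  simpa using this

theorem lintegral_enorm_pow_lt_top {d : ℕ} {E : Type*} [NormedAddCommGroup E]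
    {f : UnitAddTorus (Fin d) → E} (hf : Continuous f) (n : ℕ) :
    ∫⁻ x, ‖f x‖ₑ ^ n < ⊤ := by
  have h := ((hf.norm.pow n).integrable_of_hasCompactSupport (μ := volume)
    (HasCompactSupport.of_compactSpace _)).hasFiniteIntegral
  refine (lintegral_congr fun x => ?_).trans_lt h
  simp

/-- The Ladyzhenskaya inequality in dimension two: the endpoint inequality for `|u|²`, followed by
the Cauchy–Schwarz inequality. -/
theorem IsSmooth.lintegral_pow_four_le_two
    {u : UnitAddTorus (Fin 2) → EuclideanSpace ℝ (Fin 2)} (hu : IsSmooth u) :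
    ∫⁻ x, ‖u x‖ₑ ^ 4 ≤ eLpNorm u 2 volume ^ 2 *
      (eLpNorm u 2 volume + 2 * eLpNorm (classicalGrad u) 2 volume) ^ 2 := by
  have hc := hu.continuous
  have hc' := hu.continuous_classicalGrad
  have hp : Real.HolderConjugate ((2 : ℕ) : ℝ) 2 := by
    exact_mod_cast Real.HolderConjugate.two_two
  have h := lintegral_rpow_le_of_hasContPartial hp (fun i => hu.hasContPartial_norm_sq i)
    (D := fun x => 2 * (‖u x‖ₑ * ‖classicalGrad u x‖ₑ)) (by fun_prop) (fun i x => by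
      rw [enorm_mul]
      gcongr
      · simp [Real.enorm_eq_ofReal]
      · rw [Real.enorm_eq_ofReal_abs, ← ofReal_norm, ← ofReal_norm, ← ENNReal.ofReal_mul (by simp)]
        exact ENNReal.ofReal_le_ofReal (abs_sum_mul_partialDeriv_le u i x))
  have h2 : (∫⁻ x, ‖u x‖ₑ * ‖classicalGrad u x‖ₑ)
      ≤ eLpNorm u 2 volume * eLpNorm (classicalGrad u) 2 volume := by
    refine (ENNReal.pow_le_pow_left_iff two_ne_zero).1 ?_
    rw [mul_pow]
    have e1 := eLpNorm_natCast_pow (ν := volume) u two_ne_zero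
    have e2 := eLpNorm_natCast_pow (ν := volume) (classicalGrad u) two_ne_zero
    norm_num at e1 e2
    rw [e1, e2]
    exact sq_lintegral_mul_le (by fun_prop) (by fun_prop)
  have e1 := eLpNorm_natCast_pow (ν := volume) u two_ne_zero
  norm_num at e1
  calc ∫⁻ x, ‖u x‖ₑ ^ 4 = ∫⁻ x, ‖‖u x‖ ^ 2‖ₑ ^ (2 : ℝ) := by
        congr with x
        rw [ENNReal.rpow_two, enorm_pow, enorm_norm, ← pow_mul]
    _ ≤ _ := h
    _ = (eLpNorm u 2 volume ^ 2 + 2 * ∫⁻ x, ‖u x‖ₑ * ‖classicalGrad u x‖ₑ) ^ 2 := by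
        rw [ENNReal.rpow_two, lintegral_add_left (by fun_prop), lintegral_const_mul _ (by fun_prop),
          e1]
        simp
    _ ≤ (eLpNorm u 2 volume ^ 2
          + 2 * (eLpNorm u 2 volume * eLpNorm (classicalGrad u) 2 volume)) ^ 2 := by
        gcongr
    _ = _ := by ring

/-- The Ladyzhenskaya inequality in dimension three. The endpoint inequality is applied to `|u|⁴`;
with `Y = ∫ |u|⁶` and `X = ∫ |u|⁴`, it reads `Y ≤ (X + 4 ∫ |u|³ |∇u|) ^ (3/2)`, and both terms on
the right are at most a multiple of `√Y` by the Cauchy–Schwarz inequality. -/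
theorem IsSmooth.lintegral_pow_four_le_three
    {u : UnitAddTorus (Fin 3) → EuclideanSpace ℝ (Fin 3)} (hu : IsSmooth u) :
    ∫⁻ x, ‖u x‖ₑ ^ 4 ≤ eLpNorm u 2 volume *
      (eLpNorm u 2 volume + 4 * eLpNorm (classicalGrad u) 2 volume) ^ 3 := by
  have hc := hu.continuous
  have hc' := hu.continuous_classicalGrad
  have hp : Real.HolderConjugate ((3 : ℕ) : ℝ) (3 / 2) := by
    rw [Real.holderConjugate_iff]; norm_num
  have h := lintegral_rpow_le_of_hasContPartial hp
    (fun i => (hu.hasContPartial_norm_sq i).mul (hu.hasContPartial_norm_sq i))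
    (D := fun x => 4 * (‖u x‖ₑ ^ 3 * ‖classicalGrad u x‖ₑ)) (by fun_prop) (fun i x => by
      have h1 := abs_sum_mul_partialDeriv_le u i x
      have h2 : |2 * (∑ j, u x j * partialDeriv u i j x) * ‖u x‖ ^ 2
          + ‖u x‖ ^ 2 * (2 * ∑ j, u x j * partialDeriv u i j x)|
          ≤ 4 * (‖u x‖ ^ 3 * ‖classicalGrad u x‖) := by
        rw [show 2 * (∑ j, u x j * partialDeriv u i j x) * ‖u x‖ ^ 2
          + ‖u x‖ ^ 2 * (2 * ∑ j, u x j * partialDeriv u i j x)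
          = 4 * ‖u x‖ ^ 2 * ∑ j, u x j * partialDeriv u i j x by ring, abs_mul,
          abs_of_nonneg (by positivity : 0 ≤ 4 * ‖u x‖ ^ 2)]
        calc _ ≤ 4 * ‖u x‖ ^ 2 * (‖u x‖ * ‖classicalGrad u x‖) := by gcongr
          _ = _ := by ring
      rw [Real.enorm_eq_ofReal_abs]
      refine (ENNReal.ofReal_le_ofReal h2).trans_eq ?_
      rw [ENNReal.ofReal_mul (by simp), ENNReal.ofReal_mul (by positivity),
        ENNReal.ofReal_pow (by simp), ofReal_norm, ofReal_norm]
      simp)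
  set a := eLpNorm u 2 volume with ha
  set G := eLpNorm (classicalGrad u) 2 volume with hG
  set y := eLpNorm (fun x => ‖u x‖ ^ 3) 2 volume with hy
  have e1 := eLpNorm_natCast_pow (ν := volume) u two_ne_zero
  have e2 := eLpNorm_natCast_pow (ν := volume) (classicalGrad u) two_ne_zero
  have e3 := eLpNorm_natCast_pow (ν := volume) (fun x => ‖u x‖ ^ 3) two_ne_zero
  norm_num at e1 e2 e3
  rw [← ha] at e1
  rw [← hG] at e2
  rw [← hy] at e3
  have hafin : a ≠ ⊤ := by
    have := lintegral_enorm_pow_lt_top hc 2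
    rw [← e1] at this
    simpa using this.ne
  have hGfin : G ≠ ⊤ := by
    have := lintegral_enorm_pow_lt_top hc' 2
    rw [← e2] at this
    simpa using this.ne
  have hyfin : y ≠ ⊤ := by
    have : ∫⁻ x, ‖‖u x‖ ^ 3‖ₑ ^ 2 < ⊤ := lintegral_enorm_pow_lt_top (hc.norm.pow 3) 2
    simp only [enorm_pow, enorm_norm] at this
    rw [← e3] at this
    simpa using this.ne
  have hX : ∫⁻ x, ‖u x‖ₑ ^ 4 ≤ a * y := by
    refine (ENNReal.pow_le_pow_left_iff two_ne_zero).1 ?_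
    rw [mul_pow, e1, e3]
    refine le_trans (le_of_eq ?_) (sq_lintegral_mul_le (by fun_prop) (by fun_prop))
    congr with x
    ring
  have hQ : (∫⁻ x, ‖u x‖ₑ ^ 3 * ‖classicalGrad u x‖ₑ) ≤ y * G := by
    refine (ENNReal.pow_le_pow_left_iff two_ne_zero).1 ?_
    rw [mul_pow, e2, e3]
    exact sq_lintegral_mul_le (by fun_prop) (by fun_prop)
  have hY : (y ^ 2) ^ 2 ≤ (y * (a + 4 * G)) ^ 3 := by
    calc (y ^ 2) ^ 2 = (∫⁻ x, ‖‖u x‖ ^ 2 * ‖u x‖ ^ 2‖ₑ ^ ((3 : ℝ) / 2)) ^ 2 := by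
          rw [e3]
          congr with x
          rw [enorm_mul, enorm_pow, enorm_norm, ← pow_add, ← ENNReal.rpow_natCast (n := 2 + 2),
            ← ENNReal.rpow_mul, ← pow_mul, ← ENNReal.rpow_natCast]
          norm_num
      _ ≤ (((∫⁻ x, ‖u x‖ₑ ^ 4) + 4 * ∫⁻ x, ‖u x‖ₑ ^ 3 * ‖classicalGrad u x‖ₑ)
            ^ ((3 : ℝ) / 2)) ^ 2 := by
          gcongr
          refine h.trans_eq ?_
          rw [lintegral_add_left (by fun_prop), lintegral_const_mul _ (by fun_prop)]
          simp only [enorm_pow, enorm_norm, ← pow_add]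
      _ ≤ ((a * y + 4 * (y * G)) ^ ((3 : ℝ) / 2)) ^ 2 := by gcongr
      _ = (y * (a + 4 * G)) ^ 3 := by
          rw [← ENNReal.rpow_natCast, ← ENNReal.rpow_mul, ← ENNReal.rpow_natCast]
          norm_num
          ring_nf
  -- cancel `y ^ 3`, which is possible because `y` is finite
  have hy3 : y ≤ (a + 4 * G) ^ 3 := by
    rcases eq_or_ne y 0 with h0 | h0
    · simp [h0]
    · have h3 : y ^ 3 * y ≤ y ^ 3 * (a + 4 * G) ^ 3 := by
        calc y ^ 3 * y = (y ^ 2) ^ 2 := by ring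
          _ ≤ (y * (a + 4 * G)) ^ 3 := hY
          _ = _ := by ring
      exact (ENNReal.mul_le_mul_iff_right (by simp [h0]) (by simp [hyfin])).1 h3
  exact hX.trans (by gcongr)

/-- For smooth fields, the `L⁴` norm is bounded by an arbitrarily small multiple of the `L²` norm of
the gradient, plus a multiple of the `L²` norm. -/
theorem IsSmooth.eLpNorm_four_le {d : ℕ} (hd : d = 2 ∨ d = 3) {ε : ℝ≥0} (hε : ε ≠ 0) {u : Field d}
    (hu : IsSmooth u) :
    eLpNorm u 4 volume ≤ (4 * ε : ℝ≥0) * eLpNorm (classicalGrad u) 2 volume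
      + (ε + (ε ^ 3)⁻¹ : ℝ≥0) * eLpNorm u 2 volume := by
  have hX : ∫⁻ x, ‖u x‖ₑ ^ 4 ≤ eLpNorm u 2 volume *
      (eLpNorm u 2 volume + 4 * eLpNorm (classicalGrad u) 2 volume) ^ 3 := by
    rcases hd with rfl | rfl
    · refine hu.lintegral_pow_four_le_two.trans ?_
      calc _ = eLpNorm u 2 volume * (eLpNorm u 2 volume *
            (eLpNorm u 2 volume + 2 * eLpNorm (classicalGrad u) 2 volume) ^ 2) := by ring
        _ ≤ eLpNorm u 2 volume * ((eLpNorm u 2 volume + 4 * eLpNorm (classicalGrad u) 2 volume) *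
            (eLpNorm u 2 volume + 4 * eLpNorm (classicalGrad u) 2 volume) ^ 2) := by
          gcongr
          · exact le_self_add
          · norm_num
        _ = _ := by ring
    · exact hu.lintegral_pow_four_le_three
  have e4 := eLpNorm_natCast_pow (ν := volume) u four_ne_zero
  norm_num at e4
  rw [← e4] at hX
  generalize eLpNorm u 4 volume = x at hX ⊢
  generalize eLpNorm (classicalGrad u) 2 volume = G at hX ⊢
  generalize eLpNorm u 2 volume = a at hX ⊢
  have hε' : (ε : ℝ≥0∞) ≠ 0 := by simpa using hε
  -- either `a` is at most `ε⁴ (a + 4 G)`, or it dominates that quantity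
  rcases le_total a ((ε : ℝ≥0∞) ^ 4 * (a + 4 * G)) with h | h
  · have : x ≤ ε * (a + 4 * G) := by
      refine (ENNReal.pow_le_pow_left_iff four_ne_zero).1 (hX.trans ?_)
      calc a * (a + 4 * G) ^ 3 ≤ (ε : ℝ≥0∞) ^ 4 * (a + 4 * G) * (a + 4 * G) ^ 3 := by gcongr
        _ = _ := by ring
    refine this.trans ?_
    push_cast
    calc ε * (a + 4 * G) = 4 * ε * G + ε * a := by ring
      _ ≤ _ := by gcongr; exact le_self_add
  · have h' : ε * (a + 4 * G) ≤ ((ε ^ 3)⁻¹ : ℝ≥0) * a := by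
      rw [ENNReal.coe_inv (by positivity), ← ENNReal.mul_le_iff_le_inv (by simpa) (by simp)]
      push_cast
      calc _ = (ε : ℝ≥0∞) ^ 4 * (a + 4 * G) := by ring
        _ ≤ _ := h
    have : x ≤ ((ε ^ 3)⁻¹ : ℝ≥0) * a := by
      refine (ENNReal.pow_le_pow_left_iff four_ne_zero).1 (hX.trans ?_)
      have hcancel : ((ε ^ 3)⁻¹ : ℝ≥0) * (ε : ℝ≥0∞) ^ 3 = 1 := by
        exact_mod_cast inv_mul_cancel₀ (pow_ne_zero 3 hε)
      calc a * (a + 4 * G) ^ 3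
          = (((ε ^ 3)⁻¹ : ℝ≥0) * (ε : ℝ≥0∞) ^ 3) * (a * (a + 4 * G) ^ 3) := by
            rw [hcancel, one_mul]
        _ = ((ε ^ 3)⁻¹ : ℝ≥0) * a * (ε * (a + 4 * G)) ^ 3 := by ring
        _ ≤ ((ε ^ 3)⁻¹ : ℝ≥0) * a * (((ε ^ 3)⁻¹ : ℝ≥0) * a) ^ 3 := by gcongr
        _ = _ := by ring
    refine this.trans (le_add_left ?_)
    push_cast
    gcongr
    exact le_add_self

/-! ### The space `V` and its embedding into `L⁴` -/

/-- The element `v` of `V` is represented by the smooth divergence-free field `φ`. -/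
def IsRepresentedBy {d : ℕ} (v : V d) (φ : Field d) : Prop :=
  IsTestField φ ∧ field v =ᵐ[volume] φ ∧ grad v =ᵐ[volume] classicalGrad φ

theorem dense_isRepresentedBy (d : ℕ) : Dense {v : V d | ∃ φ, IsRepresentedBy v φ} := by
  have him : Subtype.val '' {v : V d | ∃ φ, IsRepresentedBy v φ}
      = (testSpace d : Set (L2Pair d)) := by
    ext p
    constructor
    · rintro ⟨v, hv, rfl⟩
      exact hv
    · intro hp
      exact ⟨⟨p, (testSpace d).le_topologicalClosure hp⟩, hp, rfl⟩
  refine Subtype.dense_iff.2 fun x hx => ?_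
  have hx' : x ∈ closure (testSpace d : Set (L2Pair d)) := hx
  rwa [← him] at hx'

theorem norm_field_le {d : ℕ} (v : V d) : ‖field v‖ ≤ ‖v‖ := WithLp.norm_fst_le _ (v : L2Pair d)
theorem norm_grad_le {d : ℕ} (v : V d) : ‖grad v‖ ≤ ‖v‖ := WithLp.norm_snd_le _ (v : L2Pair d)

theorem continuous_field (d : ℕ) : Continuous (field : V d → L2Field d) :=
  (WithLp.continuous_fst _ _ _).comp continuous_subtype_val
theorem continuous_grad (d : ℕ) : Continuous (grad : V d → L2Mat d) :=
  (WithLp.continuous_snd _ _ _).comp continuous_subtype_val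

@[simp] theorem field_add {d : ℕ} (v w : V d) : field (v + w) = field v + field w := rfl
@[simp] theorem field_sub {d : ℕ} (v w : V d) : field (v - w) = field v - field w := rfl
@[simp] theorem field_smul {d : ℕ} (c : ℝ) (v : V d) : field (c • v) = c • field v := rfl
@[simp] theorem grad_add {d : ℕ} (v w : V d) : grad (v + w) = grad v + grad w := rfl
@[simp] theorem grad_smul {d : ℕ} (c : ℝ) (v : V d) : grad (c • v) = c • grad v := rfl

/-- The interpolation inequality for smooth fields passes to `V` by density and Fatou's lemma. -/
theorem eLpNorm_field_four_le {d : ℕ} (hd : d = 2 ∨ d = 3) {ε : ℝ≥0} (hε : ε ≠ 0) (v : V d) :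
    eLpNorm (field v) 4 volume
      ≤ (4 * ε : ℝ≥0) * ‖grad v‖ₑ + (ε + (ε ^ 3)⁻¹ : ℝ≥0) * ‖field v‖ₑ := by
  obtain ⟨s, hs, hlim⟩ := mem_closure_iff_seq_limit.1 (dense_isRepresentedBy d v)
  have hfield : Tendsto (fun n => field (s n)) atTop (𝓝 (field v)) :=
    ((continuous_field d).tendsto v).comp hlim
  have hgrad : Tendsto (fun n => grad (s n)) atTop (𝓝 (grad v)) :=
    ((continuous_grad d).tendsto v).comp hlim
  obtain ⟨ns, hns, hae⟩ :=
    (tendstoInMeasure_of_tendsto_Lp hfield).exists_seq_tendsto_ae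
  have hbound (n : ℕ) : eLpNorm (field (s n)) 4 volume
      ≤ (4 * ε : ℝ≥0) * ‖grad (s n)‖ₑ + (ε + (ε ^ 3)⁻¹ : ℝ≥0) * ‖field (s n)‖ₑ := by
    obtain ⟨φ, hφ, h1, h2⟩ := hs n
    rw [Lp.enorm_def, Lp.enorm_def, eLpNorm_congr_ae h1, eLpNorm_congr_ae h1, eLpNorm_congr_ae h2]
    exact hφ.1.eLpNorm_four_le hd hε
  have htend : Tendsto (fun n => ((4 * ε : ℝ≥0) : ℝ≥0∞) * ‖grad (s (ns n))‖ₑ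
      + (ε + (ε ^ 3)⁻¹ : ℝ≥0) * ‖field (s (ns n))‖ₑ) atTop
      (𝓝 ((4 * ε : ℝ≥0) * ‖grad v‖ₑ + (ε + (ε ^ 3)⁻¹ : ℝ≥0) * ‖field v‖ₑ)) := by
    refine Tendsto.add ?_ ?_
    · exact ENNReal.Tendsto.const_mul ((hgrad.comp hns.tendsto_atTop).enorm)
        (Or.inr ENNReal.coe_ne_top)
    · exact ENNReal.Tendsto.const_mul ((hfield.comp hns.tendsto_atTop).enorm)
        (Or.inr ENNReal.coe_ne_top)
  calc eLpNorm (field v) 4 volume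
      ≤ atTop.liminf fun n => eLpNorm (field (s (ns n))) 4 volume :=
        Lp.eLpNorm_lim_le_liminf_eLpNorm (fun n => Lp.aestronglyMeasurable _) _ hae
    _ ≤ atTop.liminf fun n => ((4 * ε : ℝ≥0) : ℝ≥0∞) * ‖grad (s (ns n))‖ₑ
          + (ε + (ε ^ 3)⁻¹ : ℝ≥0) * ‖field (s (ns n))‖ₑ :=
        liminf_le_liminf (Eventually.of_forall fun n => hbound (ns n))
    _ = _ := htend.liminf_eq

theorem memLp_field_four {d : ℕ} (hd : d = 2 ∨ d = 3) (v : V d) : MemLp (field v) 4 volume :=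
  ⟨Lp.aestronglyMeasurable _, (eLpNorm_field_four_le hd one_ne_zero v).trans_lt (by finiteness)⟩

theorem normL4_nonneg {d : ℕ} (v : V d) : 0 ≤ normL4 v := ENNReal.toReal_nonneg

theorem exists_normL4_le {d : ℕ} (hd : d = 2 ∨ d = 3) {ε : ℝ} (hε : 0 < ε) :
    ∃ K : ℝ, 0 ≤ K ∧ ∀ v : V d, normL4 v ≤ ε * ‖grad v‖ + K * ‖field v‖ := by
  lift ε to ℝ≥0 using hε.le
  have hε' : ε / 4 ≠ 0 := by
    have : ε ≠ 0 := by
      rintro rfl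
      simp at hε
    positivity
  refine ⟨(ε / 4 + ((ε / 4) ^ 3)⁻¹ : ℝ≥0), NNReal.coe_nonneg _, fun v => ?_⟩
  have h := eLpNorm_field_four_le hd hε' v
  rw [show 4 * (ε / 4) = ε by ring] at h
  have := ENNReal.toReal_mono (by finiteness) h
  rwa [ENNReal.toReal_add (by finiteness) (by finiteness), ENNReal.toReal_mul, ENNReal.toReal_mul,
    toReal_enorm, toReal_enorm] at this

theorem exists_normL4_le_norm {d : ℕ} (hd : d = 2 ∨ d = 3) :
    ∃ K : ℝ, 0 ≤ K ∧ ∀ v : V d, normL4 v ≤ K * ‖v‖ := by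
  obtain ⟨K, hK, h⟩ := exists_normL4_le hd one_pos
  refine ⟨1 + K, by positivity, fun v => (h v).trans ?_⟩
  have h1 := norm_grad_le v
  have h2 := mul_le_mul_of_nonneg_left (norm_field_le v) hK
  linarith

theorem normL4_le_add {d : ℕ} (hd : d = 2 ∨ d = 3) (y z : V d) :
    normL4 y ≤ normL4 z + normL4 (y - z) := by
  have h : eLpNorm (field y) 4 volume
      ≤ eLpNorm (field z) 4 volume + eLpNorm (field (y - z)) 4 volume := by
    have hae : field y =ᵐ[volume] (field z : Field d) + (field (y - z) : Field d) := by
      rw [field_sub]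
      filter_upwards [Lp.coeFn_sub (field y) (field z)] with x hx
      rw [Pi.add_apply, hx, Pi.sub_apply, add_sub_cancel]
    rw [eLpNorm_congr_ae hae]
    exact eLpNorm_add_le (Lp.aestronglyMeasurable _) (Lp.aestronglyMeasurable _) (by norm_num)
  have h1 := (memLp_field_four hd z).2.ne
  have h2 := (memLp_field_four hd (y - z)).2.ne
  have := ENNReal.toReal_mono (ENNReal.add_ne_top.2 ⟨h1, h2⟩) h
  rwa [ENNReal.toReal_add h1 h2] at this

/-! ### The trilinear form -/

/-- Hölder's inequality with exponents `4`, `2`, `4`. -/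
theorem lintegral_enorm_mul_mul_le {α E F G : Type*} [MeasurableSpace α] {ν : Measure α}
    [NormedAddCommGroup E] [NormedAddCommGroup F] [NormedAddCommGroup G]
    {f : α → E} {g : α → F} {h : α → G} (hf : AEStronglyMeasurable f ν)
    (hg : AEStronglyMeasurable g ν) (hh : AEStronglyMeasurable h ν) :
    ∫⁻ x, ‖f x‖ₑ * ‖g x‖ₑ * ‖h x‖ₑ ∂ν
      ≤ eLpNorm f 4 ν * eLpNorm g 2 ν * eLpNorm h 4 ν := by
  have : ENNReal.HolderTriple 4 4 2 := ⟨by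
    rw [← ENNReal.toReal_eq_toReal_iff' (by finiteness) (by finiteness),
      ENNReal.toReal_add (by finiteness) (by finiteness)]
    norm_num⟩
  have h1 := eLpNorm_smul_le_mul_eLpNorm (p := 4) (q := 4) (r := 2) hh.norm hf.norm
  have h2 := eLpNorm_smul_le_mul_eLpNorm (p := 2) (q := 2) (r := 1) hg.norm (hf.norm.smul hh.norm)
  rw [eLpNorm_norm, eLpNorm_norm] at h1
  rw [eLpNorm_norm, eLpNorm_one_eq_lintegral_enorm] at h2
  calc ∫⁻ x, ‖f x‖ₑ * ‖g x‖ₑ * ‖h x‖ₑ ∂ν = _ := lintegral_congr fun x => by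
        simp [mul_right_comm]
    _ ≤ _ := h2
    _ ≤ eLpNorm f 4 ν * eLpNorm h 4 ν * eLpNorm g 2 ν := by gcongr
    _ = _ := by ring

theorem lintegral_enorm_b_le {d : ℕ} (y z w : V d) (i j : Fin d) :
    ∫⁻ x, ‖field y x i * grad z x (i, j) * field w x j‖ₑ
      ≤ eLpNorm (field y) 4 volume * ‖grad z‖ₑ * eLpNorm (field w) 4 volume := by
  rw [Lp.enorm_def]
  refine le_trans (lintegral_mono fun x => ?_) (lintegral_enorm_mul_mul_le
    (Lp.aestronglyMeasurable (field y)) (Lp.aestronglyMeasurable (grad z))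
    (Lp.aestronglyMeasurable (field w)))
  rw [enorm_mul, enorm_mul]
  gcongr
  all_goals exact enorm_le_iff_norm_le.2 (PiLp.norm_apply_le _ _)

theorem integrable_b {d : ℕ} (hd : d = 2 ∨ d = 3) (y z w : V d) (i j : Fin d) :
    Integrable (fun x => field y x i * grad z x (i, j) * field w x j) volume := by
  have hm {ι : Type} [Fintype ι] (f : Lp (EuclideanSpace ℝ ι) 2
      (volume : Measure (UnitAddTorus (Fin d)))) (k : ι) :
      AEStronglyMeasurable (fun x => f x k) volume :=
    (EuclideanSpace.proj (𝕜 := ℝ) k).continuous.comp_aestronglyMeasurable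
      (Lp.aestronglyMeasurable f)
  refine ⟨((hm _ i).mul (hm _ (i, j))).mul (hm _ j), (lintegral_enorm_b_le y z w i j).trans_lt ?_⟩
  exact ENNReal.mul_lt_top (ENNReal.mul_lt_top (memLp_field_four hd y).2 enorm_lt_top)
    (memLp_field_four hd w).2

theorem abs_b_le {d : ℕ} (hd : d = 2 ∨ d = 3) (y z w : V d) :
    |b y z w| ≤ (d : ℝ) ^ 2 * (normL4 y * ‖grad z‖ * normL4 w) := by
  have h (i j : Fin d) : |∫ x, field y x i * grad z x (i, j) * field w x j|
      ≤ normL4 y * ‖grad z‖ * normL4 w := by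
    have hfin := ENNReal.mul_lt_top (ENNReal.mul_lt_top (memLp_field_four hd y).2
      (enorm_lt_top (x := grad z))) (memLp_field_four hd w).2
    have := (enorm_integral_le_lintegral_enorm _).trans (lintegral_enorm_b_le y z w i j)
    have := ENNReal.toReal_mono hfin.ne this
    rwa [ENNReal.toReal_mul, ENNReal.toReal_mul, toReal_enorm, toReal_enorm] at this
  calc |b y z w| ≤ ∑ i, ∑ j, |∫ x, field y x i * grad z x (i, j) * field w x j| :=
        (Finset.abs_sum_le_sum_abs _ _).trans
          (Finset.sum_le_sum fun i _ => Finset.abs_sum_le_sum_abs _ _)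
    _ ≤ ∑ _i : Fin d, ∑ _j : Fin d, normL4 y * ‖grad z‖ * normL4 w :=
        Finset.sum_le_sum fun i _ => Finset.sum_le_sum fun j _ => h i j
    _ = _ := by simp; ring

theorem b_add_left {d : ℕ} (hd : d = 2 ∨ d = 3) (y y' z w : V d) :
    b (y + y') z w = b y z w + b y' z w := by
  simp only [b, ← Finset.sum_add_distrib]
  refine Finset.sum_congr rfl fun i _ => Finset.sum_congr rfl fun j _ => ?_
  rw [← integral_add (integrable_b hd y z w i j) (integrable_b hd y' z w i j)]
  refine integral_congr_ae ?_
  rw [field_add]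
  filter_upwards [Lp.coeFn_add (field y) (field y')] with x hx
  simp only [hx, Pi.add_apply, PiLp.add_apply]
  ring

theorem b_add_middle {d : ℕ} (hd : d = 2 ∨ d = 3) (y z z' w : V d) :
    b y (z + z') w = b y z w + b y z' w := by
  simp only [b, ← Finset.sum_add_distrib]
  refine Finset.sum_congr rfl fun i _ => Finset.sum_congr rfl fun j _ => ?_
  rw [← integral_add (integrable_b hd y z w i j) (integrable_b hd y z' w i j)]
  refine integral_congr_ae ?_
  rw [grad_add]
  filter_upwards [Lp.coeFn_add (grad z) (grad z')] with x hx
  simp only [hx, Pi.add_apply, PiLp.add_apply]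
  ring

theorem b_add_right {d : ℕ} (hd : d = 2 ∨ d = 3) (y z w w' : V d) :
    b y z (w + w') = b y z w + b y z w' := by
  simp only [b, ← Finset.sum_add_distrib]
  refine Finset.sum_congr rfl fun i _ => Finset.sum_congr rfl fun j _ => ?_
  rw [← integral_add (integrable_b hd y z w i j) (integrable_b hd y z w' i j)]
  refine integral_congr_ae ?_
  rw [field_add]
  filter_upwards [Lp.coeFn_add (field w) (field w')] with x hx
  simp only [hx, Pi.add_apply, PiLp.add_apply]
  ring

theorem b_smul_left {d : ℕ} (c : ℝ) (y z w : V d) : b (c • y) z w = c * b y z w := by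
  simp only [b, Finset.mul_sum, ← integral_const_mul]
  refine Finset.sum_congr rfl fun i _ => Finset.sum_congr rfl fun j _ => integral_congr_ae ?_
  rw [field_smul]
  filter_upwards [Lp.coeFn_smul c (field y)] with x hx
  simp only [hx, Pi.smul_apply, PiLp.smul_apply, smul_eq_mul]
  ring

theorem b_smul_middle {d : ℕ} (c : ℝ) (y z w : V d) : b y (c • z) w = c * b y z w := by
  simp only [b, Finset.mul_sum, ← integral_const_mul]
  refine Finset.sum_congr rfl fun i _ => Finset.sum_congr rfl fun j _ => integral_congr_ae ?_
  rw [grad_smul]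
  filter_upwards [Lp.coeFn_smul c (grad z)] with x hx
  simp only [hx, Pi.smul_apply, PiLp.smul_apply, smul_eq_mul]
  ring

theorem b_smul_right {d : ℕ} (c : ℝ) (y z w : V d) : b y z (c • w) = c * b y z w := by
  simp only [b, Finset.mul_sum, ← integral_const_mul]
  refine Finset.sum_congr rfl fun i _ => Finset.sum_congr rfl fun j _ => integral_congr_ae ?_
  rw [field_smul]
  filter_upwards [Lp.coeFn_smul c (field w)] with x hx
  simp only [hx, Pi.smul_apply, PiLp.smul_apply, smul_eq_mul]
  ring

theorem exists_abs_b_le_norm {d : ℕ} (hd : d = 2 ∨ d = 3) :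
    ∃ K : ℝ, ∀ y z w : V d, |b y z w| ≤ K * ‖y‖ * ‖z‖ * ‖w‖ := by
  obtain ⟨K, hK, h⟩ := exists_normL4_le_norm hd
  refine ⟨d ^ 2 * K * K, fun y z w => (abs_b_le hd y z w).trans ?_⟩
  calc (d : ℝ) ^ 2 * (normL4 y * ‖grad z‖ * normL4 w)
      ≤ d ^ 2 * ((K * ‖y‖) * ‖z‖ * (K * ‖w‖)) := by
        gcongr
        · exact normL4_nonneg w
        · exact h y
        · exact norm_grad_le z
        · exact h w
    _ = _ := by ring

theorem continuous_b_left {d : ℕ} (hd : d = 2 ∨ d = 3) (z w : V d) :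
    Continuous fun y : V d => b y z w := by
  obtain ⟨K, h⟩ := exists_abs_b_le_norm hd
  let f : V d →ₗ[ℝ] ℝ :=
    { toFun := fun y => b y z w
      map_add' := fun y y' => b_add_left hd y y' z w
      map_smul' := fun c y => b_smul_left c y z w }
  exact (f.mkContinuous (K * ‖z‖ * ‖w‖) fun y => (h y z w).trans_eq (by ring)).continuous

theorem exists_bilinear_eq_b {d : ℕ} (hd : d = 2 ∨ d = 3) (y : V d) :
    ∃ f : V d →L[ℝ] V d →L[ℝ] ℝ, ∀ z w, f z w = b y z w := by
  obtain ⟨K, h⟩ := exists_abs_b_le_norm hd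
  refine ⟨(LinearMap.mk₂ ℝ (fun z w => b y z w) (b_add_middle hd y)
    (fun c z w => b_smul_middle c y z w) (b_add_right hd y)
    (fun c z w => b_smul_right c y z w)).mkContinuous₂ (K * ‖y‖) fun z w => h y z w,
    fun z w => rfl⟩

theorem B₂_apply {d : ℕ} (hd : d = 2 ∨ d = 3) (y z w : V d) : B₂ y z w = b y z w := by
  obtain ⟨f, hf⟩ := exists_bilinear_eq_b hd y
  have h : ∃ g : StrongDual ℝ (V d), ∀ w, g w = b y z w := ⟨f z, hf z⟩
  rw [B₂, dif_pos h]
  exact h.choose_spec w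

/-! ### Antisymmetry -/

/-- `b(φ, ψ, ψ) = 0` for smooth fields: the integrand is half the divergence of `|ψ|² φ`, since
`φ` is divergence-free. -/
theorem IsTestField.sum_integral_eq_zero {d : ℕ} {φ ψ : Field d} (hφ : IsTestField φ)
    (hψ : IsTestField ψ) :
    ∑ i, ∑ j, ∫ p, φ p i * partialDeriv ψ i j p * ψ p j = 0 := by
  have hint {f : UnitAddTorus (Fin d) → ℝ} (hf : Continuous f) : Integrable f volume :=
    hf.integrable_of_hasCompactSupport (HasCompactSupport.of_compactSpace _)
  have hcomp {u : Field d} (hu : IsTestField u) (j : Fin d) : Continuous fun p => u p j :=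
    (hu.1.hasContPartial j j).cont
  have hterm (i j : Fin d) :
      Integrable (fun p => φ p i * partialDeriv ψ i j p * ψ p j) volume :=
    hint (((hcomp hφ i).mul (hψ.1.continuous_partialDeriv i j)).mul (hcomp hψ j))
  have hpart (i : Fin d) :=
    (hφ.1.hasContPartial i i).mul (hψ.1.hasContPartial_norm_sq i)
  have hzero := Finset.sum_eq_zero fun i (_ : i ∈ Finset.univ) => (hpart i).integral_eq_zero
  rw [← integral_finsetSum _ fun i _ => hint (hpart i).cont'] at hzero
  have hdiv : ∀ p, ∑ i, (partialDeriv φ i i p * ‖ψ p‖ ^ 2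
      + φ p i * (2 * ∑ j, ψ p j * partialDeriv ψ i j p))
      = 2 * ∑ i, ∑ j, φ p i * partialDeriv ψ i j p * ψ p j := by
    intro p
    rw [Finset.sum_add_distrib, ← Finset.sum_mul, hφ.2 p, zero_mul, zero_add, Finset.mul_sum]
    refine Finset.sum_congr rfl fun i _ => ?_
    rw [Finset.mul_sum, Finset.mul_sum, Finset.mul_sum]
    exact Finset.sum_congr rfl fun j _ => by ring
  simp only [hdiv] at hzero
  rw [integral_const_mul,
    integral_finsetSum _ fun i _ => integrable_finsetSum _ fun j _ => hterm i j] at hzero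
  simp only [integral_finsetSum _ fun j _ => hterm _ j] at hzero
  linarith

/-- The identity for smooth fields extends by density, in the first argument and then in the
other two. -/
theorem b_self_eq_zero {d : ℕ} (hd : d = 2 ∨ d = 3) (y w : V d) : b y w w = 0 := by
  have htest : ∀ w ∈ {w : V d | ∃ ψ, IsRepresentedBy w ψ}, ∀ y : V d, b y w w = 0 := by
    rintro w ⟨ψ, hψ, h1, h2⟩ y
    refine (dense_isRepresentedBy d).induction (P := fun y => b y w w = 0) ?_
      (isClosed_eq (continuous_b_left hd w w) continuous_const) y
    rintro y ⟨φ, hφ, h3, -⟩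
    rw [← hφ.sum_integral_eq_zero hψ]
    refine Finset.sum_congr rfl fun i _ => Finset.sum_congr rfl fun j _ => integral_congr_ae ?_
    filter_upwards [h1, h2, h3] with p e1 e2 e3
    rw [e1, e2, e3]
    rfl
  obtain ⟨f, hf⟩ := exists_bilinear_eq_b hd y
  have hcont : Continuous fun w : V d => b y w w := by
    simp only [← hf]
    exact f.continuous.clm_apply continuous_id
  exact (dense_isRepresentedBy d).induction (P := fun w => b y w w = 0)
    (fun w hw => htest w hw y) (isClosed_eq hcont continuous_const) w

theorem b_antisymm {d : ℕ} (hd : d = 2 ∨ d = 3) (y z w : V d) : b y z w = -b y w z := by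
  have h := b_self_eq_zero hd y (z + w)
  rw [b_add_middle hd, b_add_right hd, b_add_right hd, b_self_eq_zero hd, b_self_eq_zero hd] at h
  linarith

/-! ### The damped convective term -/

/-- The factor by which `BN N` damps the convective term of a field with `L⁴` norm `r`. -/
noncomputable def cutoff (N r : ℝ) : ℝ := if r ≤ N then 1 else (N / r) ^ 4

theorem BN_apply {d : ℕ} (hd : d = 2 ∨ d = 3) (N : ℕ) (y w : V d) :
    BN N y w = cutoff N (normL4 y) * b y y w := by
  unfold BN cutoff
  split_ifs <;> simp [B, B₂_apply hd]

theorem cutoff_nonneg {N r : ℝ} : 0 ≤ cutoff N r := by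
  unfold cutoff
  split_ifs
  · exact zero_le_one
  · positivity

/-- Damping keeps the product with any smaller `L⁴` norm below `N`. -/
theorem cutoff_mul_le {N r s : ℝ} (hN : 0 ≤ N) (hs : 0 ≤ s) (hsr : s ≤ r) :
    cutoff N r * s ≤ N := by
  unfold cutoff
  split_ifs with h
  · linarith
  · have hr : 0 < r := by linarith
    have hq : N / r ≤ 1 := (div_le_one hr).2 (by linarith)
    have hq0 : 0 ≤ N / r := by positivity
    calc (N / r) ^ 4 * s ≤ (N / r) ^ 1 * r := by
          gcongr ?_ * ?_
          exact pow_le_pow_of_le_one hq0 hq (by norm_num)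
      _ = N := by field_simp

theorem one_sub_pow_four_le {q : ℝ} (h1 : q ≤ 1) (h0 : 0 ≤ q) :
    |1 - q ^ 4| ≤ 4 * (1 - q) := by
  have hq : q ^ 4 ≤ 1 := pow_le_one₀ h0 h1
  rw [abs_of_nonneg (by linarith)]
  nlinarith [sq_nonneg (1 - q), sq_nonneg (1 - q ^ 2)]

theorem abs_cutoff_sub_mul_sq_le {N r s : ℝ} (hN : 0 ≤ N) (hs : 0 ≤ s) (hsr : s ≤ r) :
    |cutoff N s - cutoff N r| * s ^ 2 ≤ 4 * N * (r - s) := by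
  unfold cutoff
  split_ifs with h1 h2 h2
  · simp only [sub_self, abs_zero, zero_mul]
    have : 0 ≤ r - s := by linarith
    positivity
  · have hr : 0 < r := by linarith
    have hq : N / r ≤ 1 := (div_le_one hr).2 (by linarith)
    have hq0 : 0 ≤ N / r := by positivity
    calc |1 - (N / r) ^ 4| * s ^ 2 ≤ 4 * (1 - N / r) * N ^ 2 := by
          gcongr
          exact one_sub_pow_four_le hq hq0
      _ = 4 * N * (N / r * (r - N)) := by field_simp
      _ ≤ 4 * N * (1 * (r - s)) := by
          gcongr
          linarith
      _ = _ := by ring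
  · linarith
  · have hs' : 0 < s := by linarith
    have hr : 0 < r := by linarith
    have ht : s / r ≤ 1 := (div_le_one hr).2 hsr
    calc |(N / s) ^ 4 - (N / r) ^ 4| * s ^ 2
        = N * (N / s) ^ 2 * N * |1 - (s / r) ^ 4| := by
          rw [show (N / s) ^ 4 - (N / r) ^ 4 = (N / s) ^ 4 * (1 - (s / r) ^ 4) by field_simp,
            abs_mul, abs_of_nonneg (by positivity)]
          field_simp
      _ ≤ N * (1 : ℝ) ^ 2 * r * (4 * (1 - s / r)) := by
          gcongr
          · exact (div_le_one hs').2 (by linarith)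
          · linarith
          · exact one_sub_pow_four_le ht (by positivity)
      _ = 4 * N * (r - s) := by field_simp

/-- The difference of the damped convective terms, tested against `y - z`. If `z` has the smaller
`L⁴` norm, antisymmetry gives `b(y, y, w) = -b(y, w, z)` and `b(z, z, w) = -b(z, w, z)` for
`w = y - z`, so every term left carries a factor `∇w` and a factor controlled by `‖w‖_{L⁴}`. -/
theorem abs_BN_sub_apply_le {d : ℕ} (hd : d = 2 ∨ d = 3) (N : ℕ) (y z : V d) :
    |(BN N y - BN N z) (y - z)| ≤ d ^ 2 * (5 * N) * (normL4 (y - z) * ‖grad (y - z)‖) := by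
  wlog hzy : normL4 z ≤ normL4 y generalizing y z
  · have h := this z y (le_of_not_ge hzy)
    have e : (BN N z - BN N y) (z - y) = (BN N y - BN N z) (y - z) := by
      rw [← neg_sub y z, map_neg, ← neg_sub (BN N y) (BN N z)]
      simp
    have e' : normL4 (z - y) = normL4 (y - z) := by
      unfold normL4
      congr 1
      rw [← neg_sub y z, show field (-(y - z)) = -field (y - z) from rfl,
        eLpNorm_congr_ae (Lp.coeFn_neg _), eLpNorm_neg]
    have e'' : ‖grad (z - y)‖ = ‖grad (y - z)‖ := by
      rw [← neg_sub y z, show grad (-(y - z)) = -grad (y - z) from rfl, norm_neg]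
    rwa [e, e', e''] at h
  set w := y - z with hw
  have hy : y = w + z := by simp [hw]
  set r := normL4 y
  set s := normL4 z
  have hs : 0 ≤ s := normL4_nonneg z
  have hw0 : 0 ≤ normL4 w := normL4_nonneg w
  have hrs : r - s ≤ normL4 w := by
    have : r ≤ s + normL4 w := normL4_le_add hd y z
    linarith
  have hN : (0 : ℝ) ≤ N := N.cast_nonneg
  have hyyw : b y y w = -(b w w z + b z w z) := by
    conv_lhs => rw [b_antisymm hd]
    rw [show b y w y = b y w (w + z) by rw [← hy], b_add_right hd, b_self_eq_zero hd, zero_add,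
      show b y w z = b (w + z) w z by rw [← hy], b_add_left hd]
  have hsplit : (BN N y - BN N z) w
      = -(cutoff N r * b w w z) + (cutoff N s - cutoff N r) * b z w z := by
    change BN N y w - BN N z w = _
    rw [BN_apply hd, BN_apply hd, hyyw, b_antisymm hd z z w]
    ring
  have h1 : |cutoff N r * b w w z| ≤ d ^ 2 * N * (normL4 w * ‖grad w‖) := by
    rw [abs_mul, abs_of_nonneg cutoff_nonneg]
    calc cutoff N r * |b w w z| ≤ cutoff N r * (d ^ 2 * (normL4 w * ‖grad w‖ * s)) := by
          gcongr
          · exact cutoff_nonneg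
          · exact abs_b_le hd w w z
      _ = d ^ 2 * (cutoff N r * s) * (normL4 w * ‖grad w‖) := by ring
      _ ≤ _ := by
          gcongr
          exact cutoff_mul_le hN hs hzy
  have h2 : |(cutoff N s - cutoff N r) * b z w z| ≤ d ^ 2 * (4 * N) * (normL4 w * ‖grad w‖) := by
    rw [abs_mul]
    calc |cutoff N s - cutoff N r| * |b z w z|
        ≤ |cutoff N s - cutoff N r| * (d ^ 2 * (s * ‖grad w‖ * s)) := by
          gcongr
          exact abs_b_le hd z w z
      _ = d ^ 2 * (|cutoff N s - cutoff N r| * s ^ 2) * ‖grad w‖ := by ring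
      _ ≤ d ^ 2 * (4 * N * normL4 w) * ‖grad w‖ := by
          have h3 := (abs_cutoff_sub_mul_sq_le hN hs hzy).trans
            (mul_le_mul_of_nonneg_left hrs (by positivity))
          exact mul_le_mul_of_nonneg_right (mul_le_mul_of_nonneg_left h3 (by positivity))
            (norm_nonneg _)
      _ = _ := by ring
  rw [hsplit]
  refine (abs_add_le _ _).trans ?_
  rw [abs_neg]
  linarith

end CBF

theorem lemmaA1 (d : ℕ) (hd : d = 2 ∨ d = 3) (μ : ℝ) (hμ : 0 < μ) (N : ℕ) :
    -- every `y ∈ V` lies in `L⁴`, so that its `L⁴` norm is finite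
    (∀ y : CBF.V d, MemLp (CBF.field y) 4 volume) ∧
    -- the integrals in `b` converge, and `b(y, z, ·)` is an element of `V'`
    (∀ y z w : CBF.V d,
      (∀ i j, Integrable
        (fun x => CBF.field y x i * CBF.grad z x (i, j) * CBF.field w x j) volume) ∧
      CBF.B₂ y z w = CBF.b y z w) ∧
    -- the one-sided estimate
    ∃ C : ℝ, 0 ≤ C ∧ ∀ y z : CBF.V d,
      |(CBF.BN N y - CBF.BN N z) (y - z)| ≤
        μ / 2 * ‖CBF.grad (y - z)‖ ^ 2 + C * ‖CBF.field (y - z)‖ ^ 2 := by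
  refine ⟨CBF.memLp_field_four hd,
    fun y z w => ⟨CBF.integrable_b hd y z w, CBF.B₂_apply hd y z w⟩, ?_⟩
  set M : ℝ := d ^ 2 * (5 * N) with hM
  have hM0 : 0 ≤ M := by positivity
  obtain ⟨K, hK, h⟩ := CBF.exists_normL4_le hd (ε := μ / (4 * (M + 1))) (by positivity)
  refine ⟨(M * K) ^ 2 / μ, by positivity, fun y z => (CBF.abs_BN_sub_apply_le hd N y z).trans ?_⟩
  -- the choice of `ε` leaves half of the gradient term for Young's inequality
  have hL := h (y - z)
  set G := ‖CBF.grad (y - z)‖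
  set a := ‖CBF.field (y - z)‖
  have hG : 0 ≤ G := norm_nonneg _
  have hε : M * (μ / (4 * (M + 1))) ≤ μ / 4 := by
    rw [mul_div_assoc', div_le_div_iff₀ (by positivity) (by norm_num)]
    nlinarith
  have hyoung : M * K * a * G ≤ μ / 4 * G ^ 2 + (M * K) ^ 2 / μ * a ^ 2 := by
    have h0 : 0 ≤ μ * (G / 2 - M * K * a / μ) ^ 2 := by positivity
    have e : μ * (G / 2 - M * K * a / μ) ^ 2
        = μ / 4 * G ^ 2 + (M * K) ^ 2 / μ * a ^ 2 - M * K * a * G := by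
      field_simp
      ring
    linarith
  calc M * (CBF.normL4 (y - z) * G)
      ≤ M * ((μ / (4 * (M + 1)) * G + K * a) * G) := by gcongr
    _ = M * (μ / (4 * (M + 1))) * G ^ 2 + M * K * a * G := by ring
    _ ≤ μ / 4 * G ^ 2 + (μ / 4 * G ^ 2 + (M * K) ^ 2 / μ * a ^ 2) := by gcongr
    _ = _ := by ring
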